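/- For real $(j,h)$ let $P(x)=2(h-x)(1-x^2)-j^2$, where $j$ is the angular momentum and $h$ the energy of the spherical pendulum. For $(j,h)\neq(0,1)$ near the critical value $(0,1)$, let $x^-<x^+<x^0$ be the roots of $P$, and put $$T=2\int_{x^-}^{x^+}\frac{dx}{\sqrt{P(x)}},\qquad \Theta=\frac{1}{2\pi}\,2j\int_{x^-}^{x^+}\frac{dx}{(1-x^2)\sqrt{P(x)}}\quad(j\neq 0),\qquad \tau=-\Theta+iT .$$ Here $\Theta$ is the rotation number, measured in full turns. A branch of $\Theta$ along a curve is a continuous function that differs from $\Theta$ by an integer at every parameter with $j\ne0$. A lattice vector transported along a curve is a continuous complex-valued function whose value lies in $\mathbb Z+\mathbb Z\tau$ at every parameter with $j\neq0$. There is $\varepsilon_0>0$ such that $T$ is a continuous (single-valued) function on the punctured disc $0<j^2+(h-1)^2<\varepsilon_0^2$, and such that for every $0<\varepsilon<\varepsilon_0$ the following hold on the circuit $j=\varepsilon\cos t$, $h=1+\varepsilon\sin t$, $0\le t\le 2\pi$. 1. $P$ has three distinct real roots with $-1\le x^-<x^+\le1\le x^0$, $x^+<x^0$, and $P(x)=2(x-x^-)(x-x^+)(x-x^0)$.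 The integral for $T$ converges and $T>0$; the integral for $\Theta$ converges if $j\ne0$. 2. $T$ varies continuously along the circuit and returns to its initial value. 3. The function $\Theta$ given by the integral is continuous along the circuit where $j\neq0$. It jumps from $1$ to $-1$ at $t=\pi/2$ and from $-\tfrac12$ to $\tfrac12$ at $t=3\pi/2$, so its jumps along the circuit add up to $-1$. 4. Along the circuit taken with the positive orientation of the $(h,j)$-plane, that is $j=\varepsilon\cos t$, $h=1-\varepsilon\sin t$, a branch of $\Theta$ with initial value $\Theta(\varepsilon,1)$ exists, and the variation of every branch from $t=0$ to $t=2\pi$ equals $-1$. Run in the opposite direction $j=\varepsilon\cos t$, $h=1+\varepsilon\sin t$, a branch with the same initial value exists, and every branch varies by $+1$. 5. (Monodromy.) Along $j=\varepsilon\cos t$, $h=1-\varepsilon\sin t$, $0\le t\le2\pi$, every vector $m_0+m_1\tau$ ($m_0,m_1\in\mathbb Z$) of the lattice $\mathbb Z+\mathbb Z\tau$ at $(j,h)=(\varepsilon,1)$ can be transported, and every such transport ends at $m_0'+m_1'\tau$ with $\begin{pmatrix}m_0'\\ m_1'\end{pmatrix}=\begin{pmatrix}1&1\\0&1\end{pmatrix}\begin{pmatrix}m_0\\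 m_1\end{pmatrix}$. That is, the basis $(1,\tau)$ returns as $(1,\tau+1)$. -/

import Mathlib

open scoped Matrix Topology

noncomputable section

namespace SphericalPendulum

/-- The polynomial `P(x) = 2(h - x)(1 - x²) - j²`; the pair `p = (j, h)` consists of the angular
momentum `j = p.1` and the energy `h = p.2`. -/
def P (p : ℝ × ℝ) (x : ℝ) : ℝ := 2 * (p.2 - x) * (1 - x ^ 2) - p.1 ^ 2

/-- The smallest real root `x⁻` of `P`. -/
def xMinus (p : ℝ × ℝ) : ℝ := sInf {x | P p x = 0}

/-- The second real root `x⁺` of `P`. -/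
def xPlus (p : ℝ × ℝ) : ℝ := sInf {x | xMinus p < x ∧ P p x = 0}

/-- The third real root `x⁰` of `P`. -/
def xZero (p : ℝ × ℝ) : ℝ := sInf {x | xPlus p < x ∧ P p x = 0}

/-- The first return time `T = 2 ∫ dx / √P(x)`, the integral running from `x⁻` to `x⁺`. -/
def returnTime (p : ℝ × ℝ) : ℝ :=
  2 * ∫ x in (xMinus p)..(xPlus p), 1 / √(P p x)

/-- The rotation number in full turns,
`Θ = (1 / 2π) · 2j ∫ dx / ((1 - x²) √P(x))`, the integral running from `x⁻` to `x⁺`.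
It is meaningful for `j ≠ 0`; for `j = 0` the integral diverges, and the value is never used. -/
def rotationNumber (p : ℝ × ℝ) : ℝ :=
  1 / (2 * Real.pi) *
    (2 * p.1 * ∫ x in (xMinus p)..(xPlus p), 1 / ((1 - x ^ 2) * √(P p x)))

/-- `τ = -Θ + i T`. -/
def tau (p : ℝ × ℝ) : ℂ := -(rotationNumber p : ℂ) + Complex.I * (returnTime p : ℂ)

/-- The lattice `ℤ + ℤ τ`. -/
def periodLattice (p : ℝ × ℝ) : AddSubgroup ℂ := AddSubgroup.closure {1, tau p}

/-- The circuit `j = ε cos t`, `h = 1 + ε sin t` around the critical value `(0, 1)`. -/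
def circuit (ε t : ℝ) : ℝ × ℝ := (ε * Real.cos t, 1 + ε * Real.sin t)

/-- The same circuit run in the opposite sense, `j = ε cos t`, `h = 1 - ε sin t`. -/
def reversedCircuit (ε t : ℝ) : ℝ × ℝ := circuit ε (-t)

/-- `θ` is a continuous determination of the rotation number (which is defined up to integers)
along the curve `c`. -/
def IsRotationBranch (c : ℝ → ℝ × ℝ) (θ : ℝ → ℝ) : Prop :=
  Continuous θ ∧ ∀ t, (c t).1 ≠ 0 → ∃ n : ℤ, θ t = rotationNumber (c t) + n

/-- `u` is a continuous choice of lattice vectors along the curve `c`, that is, a lattice vector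
transported in parallel along `c`. -/
def IsLatticeTransport (c : ℝ → ℝ × ℝ) (u : ℝ → ℂ) : Prop :=
  Continuous u ∧ ∀ t, (c t).1 ≠ 0 → u t ∈ periodLattice (c t)

end SphericalPendulum

end

/-! Near `(0, 1)` the root `x⁻` stays simple and near `-1`, while `x⁺` and `x⁰` can merge at `1`
only at the critical value itself, so all roots are continuous on the punctured disc. The
substitution `x = angleParam p φ` absorbs the two inverse square root singularities: `T` becomes an
integral of `1 / outerFactor` over `[0, π]`, hence is continuous, single-valued and positive.

For `Θ`, split `1 / (1 - x²)` into its poles at `x = ±1`. At `x = -1` the integral is `π / |j|` plus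
a continuous term (`lowerPart_eq`), which contributes `sgn(j) / 2` to `Θ`. At `x = 1` the same
happens when `h > 1` (`upperPart_eq`), but when `h < 1` the integral is itself continuous across `j
= 0`. Thus `Θ` is `sgn(j)` near `j = 0`, `h > 1` and `sgn(j) / 2` near `j = 0`, `h < 1`, up to terms
carrying a factor `j`; this gives the jumps.

Modulo integers these signs are carried by one angle: `Θ = 1/2 + arg((1 - h) + i j) / 2π +
singleValuedPart`, with `singleValuedPart` continuous on the whole punctured disc
(`continuousOn_singleValuedPart`). The variation of a branch is therefore the winding number of `(1
- h) + i j`. A continuous function that is integral on a dense set is constant (`eq_int_of_dense`),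
so branches are unique up to integers and a transported lattice vector keeps constant coordinates in
the basis `1, -θ + i T`. When `θ` drops by `1`, `τ` returns as `τ + 1`. -/

noncomputable section

namespace SphericalPendulum

/-! ### Roots of the cubic on the punctured disc -/

/-- The punctured disc of radius `1 / 10` around the critical value `(0, 1)`. -/
def puncturedDisc : Set (ℝ × ℝ) :=
  {p | p ≠ (0, 1) ∧ p.1 ^ 2 + (p.2 - 1) ^ 2 < (1 / 10) ^ 2}

lemma isOpen_puncturedDisc : IsOpen puncturedDisc := by
  refine IsOpen.and isOpen_ne ?_
  exact isOpen_lt (by fun_prop) (by fun_prop)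

lemma abs_snd_sub_one_lt {p : ℝ × ℝ} (hp : p ∈ puncturedDisc) :
    9 / 10 < p.2 ∧ p.2 < 11 / 10 := by
  have h := hp.2
  constructor <;> nlinarith [sq_nonneg p.1]

lemma fst_sq_lt {p : ℝ × ℝ} (hp : p ∈ puncturedDisc) : p.1 ^ 2 < 1 / 100 := by
  have h := hp.2
  nlinarith [sq_nonneg (p.2 - 1)]

lemma exists_root_near_neg_one {p : ℝ × ℝ} (hp : p ∈ puncturedDisc) :
    ∃ a, -1 ≤ a ∧ a ≤ -9 / 10 ∧ P p a = 0 := by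
  have h1 := abs_snd_sub_one_lt hp
  have h2 := fst_sq_lt hp
  have hc : ContinuousOn (P p) (Set.Icc (-1) (-9 / 10)) := by
    unfold P; fun_prop
  have h0 : (0 : ℝ) ∈ Set.Icc (P p (-1)) (P p (-9 / 10)) := by
    simp only [P, Set.mem_Icc]
    constructor <;> nlinarith [sq_nonneg p.1]
  obtain ⟨a, ha, hPa⟩ := intermediate_value_Icc (by norm_num) hc h0
  exact ⟨a, ha.1, ha.2, hPa⟩

/-- Divide by `x - a`, with `a` the root near `-1`. Since `P(1) = -j² ≤ 0`, the monic quadratic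
cofactor is nonpositive at `1`, so its roots are real and enclose `1`. They coincide only if both
equal `1`, which forces `a = -1`, `j = 0`, `h = 1`, the excluded point. -/
lemma exists_ordered_roots {p : ℝ × ℝ} (hp : p ∈ puncturedDisc) :
    ∃ a b c : ℝ, -1 ≤ a ∧ a ≤ -9 / 10 ∧ a < b ∧ b ≤ 1 ∧ 1 ≤ c ∧ b < c ∧
      ∀ x, P p x = 2 * (x - a) * (x - b) * (x - c) := by
  obtain ⟨a, ha1, ha2, hPa⟩ := exists_root_near_neg_one hp
  have h1 := abs_snd_sub_one_lt hp
  have h2 := fst_sq_lt hp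
  -- The cofactor is `x² - s x + q`: `s` is the sum of the other two roots and `q` their product.
  set s := p.2 - a with hs
  set q := -1 - a * s with hq
  have hfac : ∀ x, P p x = 2 * (x - a) * (x ^ 2 - s * x + q) := by
    intro x
    have : P p x = P p x - P p a := by rw [hPa, sub_zero]
    rw [this]; simp only [P, hq, hs]; ring
  have hQ1 : 2 * (1 - a) * (1 - s + q) = -p.1 ^ 2 := by
    have := hfac 1
    simp only [P] at this; linarith
  have hQ : 1 - s + q ≤ 0 := by
    by_contra hcon
    push Not at hcon
    nlinarith [mul_pos (show 0 < 1 - a by linarith) hcon, sq_nonneg p.1]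
  have hdisc : 0 < s ^ 2 - 4 * q := by
    -- The gap between the discriminant and `(s - 2)²` is `-4 (1 - s + q)`, that is, `-4` times the
    -- cofactor at `1`.
    rcases (show (s - 2) ^ 2 ≤ s ^ 2 - 4 * q by nlinarith).lt_or_eq with h | h
    · exact lt_of_le_of_lt (sq_nonneg _) h
    · rcases (sq_nonneg (s - 2)).lt_or_eq with h' | h'
      · rw [← h]; exact h'
      · exfalso
        have e1 : 1 - s + q = 0 := by nlinarith
        have e2 : p.1 = 0 := by
          rw [e1, mul_zero] at hQ1
          have : p.1 ^ 2 = 0 := by linarith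
          exact pow_eq_zero_iff (two_ne_zero) |>.1 this
        have e3 : s = 2 := by
          have : s - 2 = 0 := pow_eq_zero_iff (two_ne_zero) |>.1 h'.symm
          linarith
        have e4 : a = -1 := by
          have : q = 1 := by linarith
          nlinarith
        apply hp.1
        ext
        · exact e2
        · show p.2 = 1
          linarith
  set r := √(s ^ 2 - 4 * q) with hr
  have hr0 : 0 < r := Real.sqrt_pos.2 hdisc
  have hr2 : r ^ 2 = s ^ 2 - 4 * q := Real.sq_sqrt hdisc.le
  have hr3 : |s - 2| ≤ r := by
    rw [hr]
    apply Real.abs_le_sqrt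
    nlinarith
  have hr4 := abs_le.1 hr3
  refine ⟨a, (s - r) / 2, (s + r) / 2, ha1, ha2, ?_, by linarith, by linarith, by linarith, ?_⟩
  · have : r < s - 2 * a := by
      apply lt_of_pow_lt_pow_left₀ 2 (by linarith)
      rw [hr2]
      nlinarith
    linarith
  · intro x
    rw [hfac]
    have : x ^ 2 - s * x + q = (x - (s - r) / 2) * (x - (s + r) / 2) := by nlinarith
    rw [this]; ring

/-- The roots of `P` are the three numbers of any ordered factorization. -/
lemma roots_eq {p : ℝ × ℝ} {a b c : ℝ} (hab : a < b) (hbc : b < c)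
    (hP : ∀ x, P p x = 2 * (x - a) * (x - b) * (x - c)) :
    xMinus p = a ∧ xPlus p = b ∧ xZero p = c := by
  have hz : ∀ x, P p x = 0 ↔ x = a ∨ x = b ∨ x = c := by
    intro x
    rw [hP x]
    simp [sub_eq_zero, or_assoc]
  have hm : xMinus p = a := by
    apply IsLeast.csInf_eq
    refine ⟨(hz a).2 (Or.inl rfl), fun x hx => ?_⟩
    rcases (hz x).1 hx with rfl | rfl | rfl <;> linarith
  have hp : xPlus p = b := by
    apply IsLeast.csInf_eq
    rw [hm]
    refine ⟨⟨hab, (hz b).2 (Or.inr (Or.inl rfl))⟩, fun x hx => ?_⟩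
    have := hx.1
    rcases (hz x).1 hx.2 with rfl | rfl | rfl <;> linarith
  refine ⟨hm, hp, ?_⟩
  apply IsLeast.csInf_eq
  rw [hp]
  refine ⟨⟨hbc, (hz c).2 (Or.inr (Or.inr rfl))⟩, fun x hx => ?_⟩
  have := hx.1
  rcases (hz x).1 hx.2 with rfl | rfl | rfl <;> linarith

lemma roots_spec {p : ℝ × ℝ} (hp : p ∈ puncturedDisc) :
    -1 ≤ xMinus p ∧ xMinus p ≤ -9 / 10 ∧ xMinus p < xPlus p ∧ xPlus p ≤ 1 ∧ 1 ≤ xZero p ∧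
      xPlus p < xZero p ∧
      ∀ x, P p x = 2 * (x - xMinus p) * (x - xPlus p) * (x - xZero p) := by
  obtain ⟨a, b, c, h1, h2, hab, h3, h4, hbc, hP⟩ := exists_ordered_roots hp
  obtain ⟨ha, hb, hc⟩ := roots_eq hab hbc hP
  rw [ha, hb, hc]
  exact ⟨h1, h2, hab, h3, h4, hbc, hP⟩

lemma roots_sum {p : ℝ × ℝ} (hp : p ∈ puncturedDisc) :
    xMinus p + xPlus p + xZero p = p.2 := by
  obtain ⟨-, -, -, -, -, -, hP⟩ := roots_spec hp
  have h0 := hP 0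
  have h1 := hP 1
  have h2 := hP (-1)
  have h3 := hP 2
  simp only [P] at h0 h1 h2 h3
  linarith

lemma roots_sum_mul {p : ℝ × ℝ} (hp : p ∈ puncturedDisc) :
    xMinus p * xPlus p + xMinus p * xZero p + xPlus p * xZero p = -1 := by
  obtain ⟨-, -, -, -, -, -, hP⟩ := roots_spec hp
  have h1 := hP 1
  have h2 := hP (-1)
  simp only [P] at h1 h2
  linarith

/-- This and its counterpart at `x = 1` evaluate `P(∓1) = -j²` on the factored form; they make the
pole contributions to `Θ` equal to `π / |j|` exactly. -/
lemma fst_sq_eq_neg_one {p : ℝ × ℝ} (hp : p ∈ puncturedDisc) :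
    p.1 ^ 2 = 2 * (1 + xMinus p) * (1 + xPlus p) * (1 + xZero p) := by
  obtain ⟨-, -, -, -, -, -, hP⟩ := roots_spec hp
  have h2 := hP (-1)
  simp only [P] at h2
  linarith

lemma fst_sq_eq_one {p : ℝ × ℝ} (hp : p ∈ puncturedDisc) :
    p.1 ^ 2 = 2 * (1 - xMinus p) * (1 - xPlus p) * (xZero p - 1) := by
  obtain ⟨-, -, -, -, -, -, hP⟩ := roots_spec hp
  have h2 := hP 1
  simp only [P] at h2
  linarith

lemma neg_one_lt_xMinus {p : ℝ × ℝ} (hp : p ∈ puncturedDisc) (hj : p.1 ≠ 0) :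
    -1 < xMinus p := by
  refine lt_of_le_of_ne (roots_spec hp).1 fun h => hj ?_
  have := fst_sq_eq_neg_one hp
  rw [← h] at this
  simpa using this

/-- If `x⁺ = 1` then `j = 0`, so `h < 1` would be a root of `P` strictly between `x⁻` and `x⁺`. -/
lemma xPlus_lt_one {p : ℝ × ℝ} (hp : p ∈ puncturedDisc) (hj : p.1 ≠ 0 ∨ p.2 < 1) :
    xPlus p < 1 := by
  obtain ⟨h1, h2, h3, h4, h5, h6, hP⟩ := roots_spec hp
  refine lt_of_le_of_ne h4 fun h => ?_
  have hj0 : p.1 = 0 := by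
    have := fst_sq_eq_one hp
    rw [h] at this
    simpa using this
  have hh := hj.resolve_left (not_not.2 hj0)
  have h9 := abs_snd_sub_one_lt hp
  have := hP p.2
  simp only [P, hj0, h] at this
  have hpos : 0 < 2 * (p.2 - xMinus p) * (p.2 - 1) * (p.2 - xZero p) := by
    have := mul_pos (mul_pos (show 0 < 2 * (p.2 - xMinus p) by linarith)
      (show 0 < 1 - p.2 by linarith)) (show 0 < xZero p - p.2 by linarith)
    linarith
  linarith

lemma one_lt_xZero {p : ℝ × ℝ} (hp : p ∈ puncturedDisc) (hh : 1 < p.2) : 1 < xZero p := by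
  obtain ⟨h1, h2, h3, h4, h5, h6, hP⟩ := roots_spec hp
  refine lt_of_le_of_ne h5 fun h => ?_
  have := hP p.2
  simp only [P, ← h] at this
  have hpos : 0 < 2 * (p.2 - xMinus p) * (p.2 - xPlus p) * (p.2 - 1) := by
    have := mul_pos (mul_pos (show 0 < 2 * (p.2 - xMinus p) by linarith)
      (show 0 < p.2 - xPlus p by linarith)) (show 0 < p.2 - 1 by linarith)
    linarith
  nlinarith [sq_nonneg p.1]

/-! ### Continuity of the roots -/

/-- Subtracting the two cubic equations leaves `a - a'` times a divided difference, which is at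
least `1` because both roots lie in `[-1, -9/10]`. -/
lemma abs_xMinus_sub_le {p p' : ℝ × ℝ} (hp : p ∈ puncturedDisc) (hp' : p' ∈ puncturedDisc) :
    |xMinus p - xMinus p'| ≤ 2 * |p.2 - p'.2| + |p.1 ^ 2 - p'.1 ^ 2| := by
  obtain ⟨h1, h2, -, -, -, -, hP⟩ := roots_spec hp
  obtain ⟨h1', h2', -, -, -, -, hP'⟩ := roots_spec hp'
  have e := hP (xMinus p)
  have e' := hP' (xMinus p')
  have hh := abs_snd_sub_one_lt hp
  generalize xMinus p = a at *
  generalize xMinus p' = a' at *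
  simp only [P, sub_self, mul_zero, zero_mul] at e e'
  have key : (a - a') * (2 * (a ^ 2 + a * a' + a' ^ 2 - p.2 * (a + a') - 1)) =
      -(2 * (p.2 - p'.2) * (1 - a' ^ 2)) + (p.1 ^ 2 - p'.1 ^ 2) := by linarith
  have hk : 1 ≤ 2 * (a ^ 2 + a * a' + a' ^ 2 - p.2 * (a + a') - 1) := by nlinarith
  calc |a - a'| ≤ |a - a'| * |2 * (a ^ 2 + a * a' + a' ^ 2 - p.2 * (a + a') - 1)| :=
        le_mul_of_one_le_right (abs_nonneg _) (hk.trans (le_abs_self _))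
    _ = |-(2 * (p.2 - p'.2) * (1 - a' ^ 2)) + (p.1 ^ 2 - p'.1 ^ 2)| := by rw [← abs_mul, key]
    _ ≤ |2 * (p.2 - p'.2) * (1 - a' ^ 2)| + |p.1 ^ 2 - p'.1 ^ 2| := by
        simpa only [abs_neg] using
          abs_add_le (-(2 * (p.2 - p'.2) * (1 - a' ^ 2))) (p.1 ^ 2 - p'.1 ^ 2)
    _ ≤ _ := by
        gcongr
        rw [abs_mul, abs_mul, abs_two]
        apply mul_le_of_le_one_right (by positivity)
        rw [abs_le]
        constructor <;> nlinarith

lemma continuousOn_xMinus : ContinuousOn xMinus puncturedDisc := by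
  intro p' hp'
  rw [ContinuousWithinAt, tendsto_iff_dist_tendsto_zero]
  have hlim : Filter.Tendsto (fun p : ℝ × ℝ => 2 * |p.2 - p'.2| + |p.1 ^ 2 - p'.1 ^ 2|)
      (𝓝[puncturedDisc] p') (𝓝 0) := by
    have hc : Continuous (fun p : ℝ × ℝ => 2 * |p.2 - p'.2| + |p.1 ^ 2 - p'.1 ^ 2|) := by fun_prop
    have := (hc.tendsto p').mono_left (nhdsWithin_le_nhds (s := puncturedDisc))
    simpa using this
  refine squeeze_zero' (Filter.Eventually.of_forall fun _ => dist_nonneg) ?_ hlim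
  filter_upwards [self_mem_nhdsWithin] with p hp
  exact abs_xMinus_sub_le hp hp'

/-- The right side is the root of the discriminant of the quadratic cofactor. Together with
`roots_sum` it expresses `x⁺` and `x⁰` continuously through `x⁻`. -/
lemma xZero_sub_xPlus {p : ℝ × ℝ} (hp : p ∈ puncturedDisc) :
    xZero p - xPlus p = √((p.2 - xMinus p) ^ 2 + 4 * (1 + xMinus p * (p.2 - xMinus p))) := by
  have h1 := roots_sum hp
  have h2 := roots_sum_mul hp
  symm
  rw [Real.sqrt_eq_iff_mul_self_eq]
  · rw [← h1]; linear_combination 4 * h2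
  · rw [← h1]
    nlinarith [sq_nonneg (xPlus p - xZero p)]
  · linarith [(roots_spec hp).2.2.2.2.2.1]

lemma continuousOn_xZero : ContinuousOn xZero puncturedDisc := by
  have := continuousOn_xMinus
  refine ContinuousOn.congr (f := fun p => ((p.2 - xMinus p) +
    √((p.2 - xMinus p) ^ 2 + 4 * (1 + xMinus p * (p.2 - xMinus p)))) / 2) (by fun_prop) ?_
  intro p hp
  have h1 := xZero_sub_xPlus hp
  have h2 := roots_sum hp
  simp only
  linarith

lemma continuousOn_xPlus : ContinuousOn xPlus puncturedDisc := by
  have := continuousOn_xMinus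
  have := continuousOn_xZero
  refine ContinuousOn.congr (f := fun p => p.2 - xMinus p - xZero p) (by fun_prop) ?_
  intro p hp
  have := roots_sum hp
  simp only
  linarith

/-! ### The substitution removing the endpoint singularities -/

/-- The parametrization of `[x⁻, x⁺]` by `[0, π]`. -/
def angleParam (p : ℝ × ℝ) (φ : ℝ) : ℝ :=
  (xMinus p + xPlus p) / 2 - (xPlus p - xMinus p) / 2 * Real.cos φ

/-- `√(2 (x⁰ - x))` along the parametrization of `[x⁻, x⁺]` by `[0, π]`. -/
def outerFactor (p : ℝ × ℝ) (φ : ℝ) : ℝ := √(2 * (xZero p - angleParam p φ))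

lemma angleParam_mem {p : ℝ × ℝ} (hp : p ∈ puncturedDisc) (φ : ℝ) :
    angleParam p φ ∈ Set.Icc (xMinus p) (xPlus p) := by
  have h := (roots_spec hp).2.2.1
  have h1 := Real.neg_one_le_cos φ
  have h2 := Real.cos_le_one φ
  unfold angleParam
  constructor <;> nlinarith

lemma two_mul_xZero_sub_pos {p : ℝ × ℝ} (hp : p ∈ puncturedDisc) (φ : ℝ) :
    0 < 2 * (xZero p - angleParam p φ) := by
  linarith [(angleParam_mem hp φ).2, (roots_spec hp).2.2.2.2.2.1]

lemma outerFactor_pos {p : ℝ × ℝ} (hp : p ∈ puncturedDisc) (φ : ℝ) : 0 < outerFactor p φ :=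
  Real.sqrt_pos.2 (two_mul_xZero_sub_pos hp φ)

lemma outerFactor_sq {p : ℝ × ℝ} (hp : p ∈ puncturedDisc) (φ : ℝ) :
    outerFactor p φ ^ 2 = 2 * (xZero p - angleParam p φ) :=
  Real.sq_sqrt (two_mul_xZero_sub_pos hp φ).le

lemma continuousOn_angleParam :
    ContinuousOn (fun q : (ℝ × ℝ) × ℝ => angleParam q.1 q.2) (puncturedDisc ×ˢ Set.univ) := by
  have h1 : ContinuousOn (fun q : (ℝ × ℝ) × ℝ => xMinus q.1) (puncturedDisc ×ˢ Set.univ) :=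
    continuousOn_xMinus.comp continuousOn_fst fun _ h => h.1
  have h2 : ContinuousOn (fun q : (ℝ × ℝ) × ℝ => xPlus q.1) (puncturedDisc ×ˢ Set.univ) :=
    continuousOn_xPlus.comp continuousOn_fst fun _ h => h.1
  unfold angleParam
  fun_prop

lemma continuousOn_outerFactor :
    ContinuousOn (fun q : (ℝ × ℝ) × ℝ => outerFactor q.1 q.2) (puncturedDisc ×ˢ Set.univ) := by
  have h1 := continuousOn_angleParam
  have h2 : ContinuousOn (fun q : (ℝ × ℝ) × ℝ => xZero q.1) (puncturedDisc ×ˢ Set.univ) :=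
    continuousOn_xZero.comp continuousOn_fst fun _ h => h.1
  unfold outerFactor
  fun_prop

/-- Along the parametrization `(x - x⁻)(x⁺ - x)` is the square of `(x⁺ - x⁻) / 2 · sin φ`, which is
also `dx / dφ`; the two cancel in `dx / √P`. -/
lemma sqrt_P_angleParam {p : ℝ × ℝ} (hp : p ∈ puncturedDisc) {φ : ℝ} (hφ : 0 ≤ Real.sin φ) :
    √(P p (angleParam p φ)) = (xPlus p - xMinus p) / 2 * Real.sin φ * outerFactor p φ := by
  obtain ⟨-, -, h, -, -, -, hP⟩ := roots_spec hp
  have h0 : 0 ≤ (xPlus p - xMinus p) / 2 * Real.sin φ * outerFactor p φ :=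
    mul_nonneg (mul_nonneg (by linarith) hφ) (outerFactor_pos hp φ).le
  rw [← Real.sqrt_sq h0, mul_pow, outerFactor_sq hp, hP]
  congr 1
  unfold angleParam
  linear_combination ((xPlus p - xMinus p) / 2) ^ 2 * (2 * ((xMinus p + xPlus p) / 2 -
    (xPlus p - xMinus p) / 2 * Real.cos φ - xZero p)) * Real.sin_sq_add_cos_sq φ

lemma injOn_angleParam {p : ℝ × ℝ} (hp : p ∈ puncturedDisc) :
    Set.InjOn (angleParam p) (Set.Ioo 0 Real.pi) := by
  intro x hx y hy hxy
  have h := (roots_spec hp).2.2.1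
  refine Real.injOn_cos ⟨hx.1.le, hx.2.le⟩ ⟨hy.1.le, hy.2.le⟩ ?_
  simp only [angleParam] at hxy
  refine mul_left_cancel₀ (show (xPlus p - xMinus p) / 2 ≠ 0 by linarith) ?_
  linarith

lemma image_angleParam {p : ℝ × ℝ} (hp : p ∈ puncturedDisc) :
    angleParam p '' Set.Ioo 0 Real.pi = Set.Ioo (xMinus p) (xPlus p) := by
  have h := (roots_spec hp).2.2.1
  ext y
  constructor
  · rintro ⟨φ, hφ, rfl⟩
    have hs := Real.sin_pos_of_mem_Ioo hφ
    have hsc := Real.sin_sq_add_cos_sq φ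
    have h1 : -1 < Real.cos φ := by nlinarith
    have h2 : Real.cos φ < 1 := by nlinarith
    unfold angleParam
    constructor <;> nlinarith
  · rintro ⟨h1, h2⟩
    set r := (xPlus p - xMinus p) / 2 with hr
    have hr0 : 0 < r := by linarith
    set v := ((xMinus p + xPlus p) / 2 - y) / r with hv
    have hv1 : -1 < v := by rw [hv, lt_div_iff₀ hr0]; linarith
    have hv2 : v < 1 := by rw [hv, div_lt_iff₀ hr0]; linarith
    refine ⟨Real.arccos v, ⟨Real.arccos_pos.2 hv2, ?_⟩, ?_⟩
    · refine lt_of_le_of_ne (Real.arccos_le_pi v) fun h => ?_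
      exact absurd (Real.arccos_eq_pi.1 h) (by linarith)
    · unfold angleParam
      rw [Real.cos_arccos hv1.le hv2.le, ← hr, hv, mul_div_cancel₀ _ hr0.ne']
      ring

lemma hasDerivAt_angleParam (p : ℝ × ℝ) (φ : ℝ) :
    HasDerivAt (angleParam p) ((xPlus p - xMinus p) / 2 * Real.sin φ) φ := by
  exact (((Real.hasDerivAt_cos φ).const_mul ((xPlus p - xMinus p) / 2)).const_sub
    ((xMinus p + xPlus p) / 2)).congr_deriv (by ring)

lemma deriv_smul_eq {p : ℝ × ℝ} (hp : p ∈ puncturedDisc) (g : ℝ → ℝ) {φ : ℝ}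
    (hφ : φ ∈ Set.Ioo 0 Real.pi) :
    |(xPlus p - xMinus p) / 2 * Real.sin φ| •
      (1 / (g (angleParam p φ) * √(P p (angleParam p φ)))) =
      1 / (g (angleParam p φ) * outerFactor p φ) := by
  have h := (roots_spec hp).2.2.1
  have hs := Real.sin_pos_of_mem_Ioo hφ
  have hpos : 0 < (xPlus p - xMinus p) / 2 * Real.sin φ := mul_pos (by linarith) hs
  rw [sqrt_P_angleParam hp hs.le, abs_of_pos hpos, smul_eq_mul]
  generalize (xPlus p - xMinus p) / 2 * Real.sin φ = w at *
  have := hpos.ne'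
  rw [mul_left_comm, mul_one_div, div_mul_eq_div_div, div_self this]

/-- The substitution that removes the square root singularities at the two endpoints. -/
lemma integral_inv_sqrt_P {p : ℝ × ℝ} (hp : p ∈ puncturedDisc) (g : ℝ → ℝ) :
    ∫ x in (xMinus p)..(xPlus p), 1 / (g x * √(P p x)) =
      ∫ φ in (0 : ℝ)..Real.pi, 1 / (g (angleParam p φ) * outerFactor p φ) := by
  have h := (roots_spec hp).2.2.1
  rw [intervalIntegral.integral_of_le h.le, intervalIntegral.integral_of_le Real.pi_pos.le,
    -- Open intervals are needed: the cancellation in `deriv_smul_eq` divides by `sin φ`.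
    MeasureTheory.integral_Ioc_eq_integral_Ioo, MeasureTheory.integral_Ioc_eq_integral_Ioo,
    ← image_angleParam hp, MeasureTheory.integral_image_eq_integral_abs_deriv_smul
      measurableSet_Ioo (fun x _ => (hasDerivAt_angleParam p x).hasDerivWithinAt)
      (injOn_angleParam hp)]
  exact MeasureTheory.setIntegral_congr_fun measurableSet_Ioo fun φ hφ => deriv_smul_eq hp g hφ

lemma intervalIntegrable_inv_sqrt_P {p : ℝ × ℝ} (hp : p ∈ puncturedDisc) {g : ℝ → ℝ}
    (hg : Continuous g) (hg0 : ∀ x ∈ Set.Icc (xMinus p) (xPlus p), g x ≠ 0) :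
    IntervalIntegrable (fun x => 1 / (g x * √(P p x))) MeasureTheory.volume
      (xMinus p) (xPlus p) := by
  have h := (roots_spec hp).2.2.1
  rw [intervalIntegrable_iff_integrableOn_Ioo_of_le h.le, ← image_angleParam hp,
    MeasureTheory.integrableOn_image_iff_integrableOn_abs_deriv_smul
      measurableSet_Ioo (fun x _ => (hasDerivAt_angleParam p x).hasDerivWithinAt)
      (injOn_angleParam hp)]
  rw [MeasureTheory.integrableOn_congr_fun (fun φ hφ => deriv_smul_eq hp g hφ) measurableSet_Ioo,
    ← intervalIntegrable_iff_integrableOn_Ioo_of_le Real.pi_pos.le]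
  apply Continuous.intervalIntegrable
  have h1 : Continuous (angleParam p) := by unfold angleParam; fun_prop
  have h2 : Continuous (outerFactor p) := by unfold outerFactor; fun_prop
  refine continuous_const.div ((hg.comp h1).mul h2) fun φ => ?_
  exact mul_ne_zero (hg0 _ (angleParam_mem hp φ)) (outerFactor_pos hp φ).ne'

lemma continuousOn_parametric_integral {X : Type*} [TopologicalSpace X]
    [FirstCountableTopology X] {S : Set X} {k : X → ℝ → ℝ}
    (hk : ContinuousOn (fun q : X × ℝ => k q.1 q.2) (S ×ˢ Set.univ)) (a b : ℝ) :
    ContinuousOn (fun p => ∫ φ in a..b, k p φ) S := by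
  rw [continuousOn_iff_continuous_domRestrict]
  refine intervalIntegral.continuous_parametric_intervalIntegral_of_continuous'
    (f := fun (p : S) φ => k p φ) ?_ a b
  exact hk.comp_continuous (f := fun q : S × ℝ => ((q.1 : X), q.2)) (by fun_prop)
    fun q => ⟨q.1.2, trivial⟩

/-- The usual primitive in `tan (φ / 2)` blows up at `φ = π`. The one used here is smooth everywhere
because `0 ≤ β < 1`, and its arctangent term vanishes at both endpoints. -/
lemma integral_one_div_sub_cos {A r : ℝ} (hr : 0 ≤ r) (hA : r < A) :
    ∫ φ in (0 : ℝ)..Real.pi, 1 / (A - r * Real.cos φ) = Real.pi / √(A ^ 2 - r ^ 2) := by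
  have hS2 : 0 < A ^ 2 - r ^ 2 := by nlinarith
  set S := √(A ^ 2 - r ^ 2) with hS
  have hS0 : 0 < S := Real.sqrt_pos.2 hS2
  have hSS : S ^ 2 = A ^ 2 - r ^ 2 := Real.sq_sqrt hS2.le
  set β := r / (A + S) with hβ
  have hAS : 0 < A + S := by linarith
  have hβ0 : 0 ≤ β := div_nonneg hr hAS.le
  have hβ1 : β < 1 := by rw [hβ, div_lt_one hAS]; linarith
  have hden : ∀ φ, 0 < 1 - β * Real.cos φ := fun φ => by
    nlinarith [Real.cos_le_one φ, Real.neg_one_le_cos φ]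
  have hA' : ∀ φ, 0 < A - r * Real.cos φ := fun φ => by
    nlinarith [Real.cos_le_one φ, Real.neg_one_le_cos φ]
  have hd : ∀ φ, HasDerivAt
      (fun φ => (φ + 2 * Real.arctan (β * Real.sin φ / (1 - β * Real.cos φ))) / S)
      (1 / (A - r * Real.cos φ)) φ := by
    intro φ
    have h1 : HasDerivAt (fun φ => β * Real.sin φ) (β * Real.cos φ) φ :=
      (Real.hasDerivAt_sin φ).const_mul β
    have h2 : HasDerivAt (fun φ => 1 - β * Real.cos φ) (β * Real.sin φ) φ :=
      (((Real.hasDerivAt_cos φ).const_mul β).const_sub 1).congr_deriv (by ring)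
    have h3 := ((hasDerivAt_id φ).add (((h1.div h2 (hden φ).ne').arctan).const_mul 2)).div_const S
    refine h3.congr_deriv ?_
    have hE : 0 < 1 - 2 * β * Real.cos φ + β ^ 2 := by
      nlinarith [hden φ, Real.cos_le_one φ, Real.neg_one_le_cos φ, sq_nonneg (1 - β),
        mul_nonneg hβ0 (sub_nonneg.2 (Real.cos_le_one φ)), mul_pos (sub_pos.2 hβ1) (sub_pos.2 hβ1)]
    have hβr : r = β * (A + S) := by rw [hβ, div_mul_cancel₀ _ hAS.ne']
    -- Equivalent to `(A - S) = β² (A + S)`, from `r² = A² - S²`.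
    have hAβ : A * (1 - β ^ 2) = S * (1 + β ^ 2) := by
      have : (A + S) * (A - S) = (A + S) * (β ^ 2 * (A + S)) := by
        linear_combination -hSS + (r + β * (A + S)) * hβr
      linarith [mul_left_cancel₀ hAS.ne' this]
    have e1 : (β * Real.sin φ / (1 - β * Real.cos φ)) ^ 2 =
        (1 - 2 * β * Real.cos φ + β ^ 2) / (1 - β * Real.cos φ) ^ 2 - 1 := by
      have := (hden φ).ne'
      field_simp
      linear_combination β ^ 2 * Real.sin_sq_add_cos_sq φ
    have e2 : β * Real.cos φ * (1 - β * Real.cos φ) - β * Real.sin φ * (β * Real.sin φ) =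
        β * Real.cos φ - β ^ 2 := by
      linear_combination -β ^ 2 * Real.sin_sq_add_cos_sq φ
    have e3 : (1 - β ^ 2) * (A - r * Real.cos φ) = S * (1 - 2 * β * Real.cos φ + β ^ 2) := by
      linear_combination (1 - β * Real.cos φ) * hAβ - (1 - β ^ 2) * Real.cos φ * hβr
    rw [Pi.div_apply, e1, e2, add_sub_cancel, one_div_div,
      div_mul_div_cancel₀' (pow_ne_zero 2 (hden φ).ne'),
      div_eq_div_iff hS0.ne' (hA' φ).ne']
    have : 1 + 2 * ((β * Real.cos φ - β ^ 2) / (1 - 2 * β * Real.cos φ + β ^ 2)) =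
        (1 - β ^ 2) / (1 - 2 * β * Real.cos φ + β ^ 2) := by
      field_simp
      ring
    rw [this, div_mul_eq_mul_div, e3, mul_div_cancel_right₀ _ hE.ne', one_mul]
  rw [intervalIntegral.integral_eq_sub_of_hasDerivAt (fun φ _ => hd φ)]
  · simp
  · refine Continuous.intervalIntegrable (continuous_const.div (by fun_prop) fun φ => (hA' φ).ne') _ _

/-! ### The return time -/

lemma returnTime_eq {p : ℝ × ℝ} (hp : p ∈ puncturedDisc) :
    returnTime p = 2 * ∫ φ in (0 : ℝ)..Real.pi, 1 / outerFactor p φ := by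
  have := integral_inv_sqrt_P hp (fun _ => 1)
  simp only [one_mul] at this
  rw [returnTime, this]

lemma continuous_outerFactor (p : ℝ × ℝ) : Continuous (outerFactor p) := by
  unfold outerFactor angleParam; fun_prop

lemma continuous_angleParam (p : ℝ × ℝ) : Continuous (angleParam p) := by
  unfold angleParam; fun_prop

lemma returnTime_pos {p : ℝ × ℝ} (hp : p ∈ puncturedDisc) : 0 < returnTime p := by
  rw [returnTime_eq hp]
  refine mul_pos two_pos ?_
  refine intervalIntegral.intervalIntegral_pos_of_pos_on ?_
    (fun φ _ => one_div_pos.2 (outerFactor_pos hp φ)) Real.pi_pos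
  exact (continuous_const.div (continuous_outerFactor p)
    fun φ => (outerFactor_pos hp φ).ne').intervalIntegrable _ _

lemma continuousOn_returnTime : ContinuousOn returnTime puncturedDisc := by
  refine ContinuousOn.congr (f := fun p => 2 * ∫ φ in (0 : ℝ)..Real.pi, 1 / outerFactor p φ) ?_
    fun p hp => returnTime_eq hp
  refine continuousOn_const.mul (continuousOn_parametric_integral ?_ 0 Real.pi)
  exact continuousOn_const.div continuousOn_outerFactor fun q hq => (outerFactor_pos hq.1 _).ne'

/-! ### Splitting the rotation number at the poles -/

/-- The regular part left after splitting off the residue at a pole `x = e` of `1 / (1 - x²)`,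
where `d = 2 (x⁰ - e)`. -/
def regularPart (p : ℝ × ℝ) (d : ℝ) : ℝ :=
  ∫ φ in (0 : ℝ)..Real.pi, 2 / (outerFactor p φ * √d * (outerFactor p φ + √d))

/-- The contribution of the pole `x = 1` to the rotation number, up to a factor `j / 2π`. -/
def upperPart (p : ℝ × ℝ) : ℝ :=
  ∫ φ in (0 : ℝ)..Real.pi, 1 / ((1 - angleParam p φ) * outerFactor p φ)

/-- The contribution of the pole `x = -1` to the rotation number, up to a factor `j / 2π`. -/
def lowerPart (p : ℝ × ℝ) : ℝ :=
  ∫ φ in (0 : ℝ)..Real.pi, 1 / ((1 + angleParam p φ) * outerFactor p φ)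

lemma one_add_angleParam_pos {p : ℝ × ℝ} (hp : p ∈ puncturedDisc) (hj : p.1 ≠ 0) (φ : ℝ) :
    0 < 1 + angleParam p φ := by
  linarith [(angleParam_mem hp φ).1, neg_one_lt_xMinus hp hj]

lemma one_sub_angleParam_pos {p : ℝ × ℝ} (hp : p ∈ puncturedDisc) (hj : p.1 ≠ 0 ∨ p.2 < 1)
    (φ : ℝ) : 0 < 1 - angleParam p φ := by
  linarith [(angleParam_mem hp φ).2, xPlus_lt_one hp hj]

lemma rotationNumber_eq_parts {p : ℝ × ℝ} (hp : p ∈ puncturedDisc) (hj : p.1 ≠ 0) :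
    rotationNumber p = p.1 / (2 * Real.pi) * (lowerPart p + upperPart p) := by
  have h1 := fun φ => (one_add_angleParam_pos hp hj φ).ne'
  have h2 := fun φ => (one_sub_angleParam_pos hp (Or.inl hj) φ).ne'
  have h3 := fun φ => (outerFactor_pos hp φ).ne'
  have c1 := continuous_angleParam p
  have c2 := continuous_outerFactor p
  have hsum : lowerPart p + upperPart p =
      2 * ∫ φ in (0 : ℝ)..Real.pi, 1 / ((1 - angleParam p φ ^ 2) * outerFactor p φ) := by
    rw [lowerPart, upperPart, ← intervalIntegral.integral_add, ← intervalIntegral.integral_const_mul]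
    · refine intervalIntegral.integral_congr fun φ _ => ?_
      have e : 1 - angleParam p φ ^ 2 = (1 + angleParam p φ) * (1 - angleParam p φ) := by ring
      have := h1 φ
      have := h2 φ
      have := h3 φ
      simp only [e]
      field_simp
      ring
    · exact (continuous_const.div (by fun_prop)
        fun φ => mul_ne_zero (h1 φ) (h3 φ)).intervalIntegrable _ _
    · exact (continuous_const.div (by fun_prop)
        fun φ => mul_ne_zero (h2 φ) (h3 φ)).intervalIntegrable _ _
  rw [hsum, rotationNumber, integral_inv_sqrt_P hp (fun x => 1 - x ^ 2)]
  ring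

lemma integral_one_div_one_add_angleParam {p : ℝ × ℝ} (hp : p ∈ puncturedDisc) (hj : p.1 ≠ 0) :
    ∫ φ in (0 : ℝ)..Real.pi, 1 / (1 + angleParam p φ) =
      Real.pi / √((1 + xMinus p) * (1 + xPlus p)) := by
  have h := (roots_spec hp).2.2.1
  have h1 := neg_one_lt_xMinus hp hj
  rw [show (1 + xMinus p) * (1 + xPlus p) = (1 + (xMinus p + xPlus p) / 2) ^ 2 -
    ((xPlus p - xMinus p) / 2) ^ 2 by ring,
    ← integral_one_div_sub_cos (by linarith) (by linarith)]
  refine intervalIntegral.integral_congr fun φ _ => ?_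
  simp only [angleParam, add_sub_assoc]

lemma integral_one_div_one_sub_angleParam {p : ℝ × ℝ} (hp : p ∈ puncturedDisc) (hj : p.1 ≠ 0) :
    ∫ φ in (0 : ℝ)..Real.pi, 1 / (1 - angleParam p φ) =
      Real.pi / √((1 - xMinus p) * (1 - xPlus p)) := by
  have h := (roots_spec hp).2.2.1
  have h1 := xPlus_lt_one hp (Or.inl hj)
  rw [show (1 - xMinus p) * (1 - xPlus p) = (1 - (xMinus p + xPlus p) / 2) ^ 2 -
    ((xPlus p - xMinus p) / 2) ^ 2 by ring,
    ← integral_one_div_sub_cos (by linarith) (by linarith),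
    -- The reflection `φ ↦ π - φ` flips the sign of the cosine in `1 - x`, giving the form `A - r
    -- cos φ`.
    ← sub_zero Real.pi, ← sub_self Real.pi, ← intervalIntegral.integral_comp_sub_left]
  simp only [sub_self, sub_zero]
  refine intervalIntegral.integral_congr fun φ _ => ?_
  simp only [angleParam, Real.cos_pi_sub]
  ring_nf

/-- With `u = outerFactor p φ` and `v = √(2 (x⁰ + 1))` one has `v² - u² = 2 (1 + x)`, hence `1 / ((1
+ x) u) = 1 / ((1 + x) v) + 2 / (u v (u + v))`. The first term integrates to `π / |j|`; the second
has no pole. -/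
lemma lowerPart_eq {p : ℝ × ℝ} (hp : p ∈ puncturedDisc) (hj : p.1 ≠ 0) :
    lowerPart p = Real.pi / |p.1| + regularPart p (2 * (xZero p + 1)) := by
  have h1 := fun φ => (one_add_angleParam_pos hp hj φ).ne'
  have h3 := fun φ => outerFactor_pos hp φ
  have c1 := continuous_angleParam p
  have c2 := continuous_outerFactor p
  have hd : 0 < 2 * (xZero p + 1) := by linarith [(roots_spec hp).2.2.2.2.1]
  have hv := Real.sqrt_pos.2 hd
  have hv2 := Real.sq_sqrt hd.le
  have hab : 0 ≤ (1 + xMinus p) * (1 + xPlus p) :=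
    mul_nonneg (by linarith [(roots_spec hp).1])
      (by linarith [(roots_spec hp).1, (roots_spec hp).2.2.1])
  have habs : |p.1| = √((1 + xMinus p) * (1 + xPlus p)) * √(2 * (xZero p + 1)) := by
    rw [← Real.sqrt_mul hab, ← Real.sqrt_sq_eq_abs, fst_sq_eq_neg_one hp]
    congr 1; ring
  rw [habs, ← div_div, ← integral_one_div_one_add_angleParam hp hj, regularPart,
    ← intervalIntegral.integral_div, ← intervalIntegral.integral_add, lowerPart]
  · refine intervalIntegral.integral_congr fun φ _ => ?_
    have e := outerFactor_sq hp φ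
    have := h1 φ
    have := (h3 φ).ne'
    have := hv.ne'
    have := (add_pos (h3 φ) hv).ne'
    generalize √(2 * (xZero p + 1)) = v at *
    generalize outerFactor p φ = u at *
    field_simp
    linear_combination hv2 - e
  · exact ((continuous_const.div (by fun_prop) h1).div_const _).intervalIntegrable _ _
  · exact (continuous_const.div (by fun_prop) fun φ => mul_ne_zero
      (mul_ne_zero (h3 φ).ne' hv.ne') (add_pos (h3 φ) hv).ne').intervalIntegrable _ _

/-- As for the lower pole, but now `u² - v² = 2 (1 - x)`, which reverses the sign of the regular
part. The condition `h > 1` keeps `x⁰ > 1`, so that `v = √(2 (x⁰ - 1))` is positive. -/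
lemma upperPart_eq {p : ℝ × ℝ} (hp : p ∈ puncturedDisc) (hj : p.1 ≠ 0) (hh : 1 < p.2) :
    upperPart p = Real.pi / |p.1| - regularPart p (2 * (xZero p - 1)) := by
  have h1 := fun φ => (one_sub_angleParam_pos hp (Or.inl hj) φ).ne'
  have h3 := fun φ => outerFactor_pos hp φ
  have c1 := continuous_angleParam p
  have c2 := continuous_outerFactor p
  have hd : 0 < 2 * (xZero p - 1) := by linarith [one_lt_xZero hp hh]
  have hv := Real.sqrt_pos.2 hd
  have hv2 := Real.sq_sqrt hd.le
  have hab : 0 ≤ (1 - xMinus p) * (1 - xPlus p) :=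
    mul_nonneg (by linarith [(roots_spec hp).2.1])
      (by linarith [(roots_spec hp).2.2.2.1])
  have habs : |p.1| = √((1 - xMinus p) * (1 - xPlus p)) * √(2 * (xZero p - 1)) := by
    rw [← Real.sqrt_mul hab, ← Real.sqrt_sq_eq_abs, fst_sq_eq_one hp]
    congr 1; ring
  rw [habs, ← div_div, ← integral_one_div_one_sub_angleParam hp hj, regularPart,
    ← intervalIntegral.integral_div, ← intervalIntegral.integral_sub, upperPart]
  · refine intervalIntegral.integral_congr fun φ _ => ?_
    have e := outerFactor_sq hp φ
    have := h1 φ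
    have := (h3 φ).ne'
    have := hv.ne'
    have := (add_pos (h3 φ) hv).ne'
    generalize √(2 * (xZero p - 1)) = v at *
    generalize outerFactor p φ = u at *
    field_simp
    linear_combination hv2 - e
  · exact ((continuous_const.div (by fun_prop) h1).div_const _).intervalIntegrable _ _
  · exact (continuous_const.div (by fun_prop) fun φ => mul_ne_zero
      (mul_ne_zero (h3 φ).ne' hv.ne') (add_pos (h3 φ) hv).ne').intervalIntegrable _ _

lemma continuousOn_regularPart {S : Set (ℝ × ℝ)} (hS : S ⊆ puncturedDisc) {d : ℝ × ℝ → ℝ}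
    (hd : ContinuousOn d S) (hd0 : ∀ p ∈ S, 0 < d p) :
    ContinuousOn (fun p => regularPart p (d p)) S := by
  have hsub : S ×ˢ (Set.univ : Set ℝ) ⊆ puncturedDisc ×ˢ Set.univ :=
    Set.prod_mono hS subset_rfl
  have h1 := continuousOn_outerFactor.mono hsub
  have h2 : ContinuousOn (fun q : (ℝ × ℝ) × ℝ => d q.1) (S ×ˢ Set.univ) :=
    hd.comp continuousOn_fst fun _ h => h.1
  refine continuousOn_parametric_integral ?_ 0 Real.pi
  refine continuousOn_const.div ((h1.mul h2.sqrt).mul (h1.add h2.sqrt)) fun q hq => ?_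
  have a1 := outerFactor_pos (hS hq.1) q.2
  have a2 := Real.sqrt_pos.2 (hd0 _ hq.1)
  exact (mul_pos (mul_pos a1 a2) (add_pos a1 a2)).ne'

lemma continuousOn_regularPart_lower :
    ContinuousOn (fun p => regularPart p (2 * (xZero p + 1))) puncturedDisc :=
  continuousOn_regularPart subset_rfl
    (continuousOn_const.mul (continuousOn_xZero.add continuousOn_const))
    fun p hp => by linarith [(roots_spec hp).2.2.2.2.1]

lemma continuousOn_regularPart_upper :
    ContinuousOn (fun p => regularPart p (2 * (xZero p - 1))) (puncturedDisc ∩ {p | 1 < p.2}) :=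
  continuousOn_regularPart Set.inter_subset_left
    (continuousOn_const.mul ((continuousOn_xZero.mono Set.inter_subset_left).sub continuousOn_const))
    fun p hp => by linarith [one_lt_xZero hp.1 hp.2]

/-- For `h < 1` the root `x⁺` stays below `1` even at `j = 0`, so the pole `x = 1` is never reached
and nothing has to be split off. -/
lemma continuousOn_upperPart :
    ContinuousOn upperPart (puncturedDisc ∩ {p | p.1 ≠ 0 ∨ p.2 < 1}) := by
  have hsub : (puncturedDisc ∩ {p | p.1 ≠ 0 ∨ p.2 < 1}) ×ˢ (Set.univ : Set ℝ) ⊆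
      puncturedDisc ×ˢ Set.univ := Set.prod_mono Set.inter_subset_left subset_rfl
  have h1 := continuousOn_outerFactor.mono hsub
  have h2 := continuousOn_angleParam.mono hsub
  refine continuousOn_parametric_integral ?_ 0 Real.pi
  refine continuousOn_const.div (by fun_prop) fun q hq => ?_
  exact (mul_pos (one_sub_angleParam_pos hq.1.1 hq.1.2 q.2) (outerFactor_pos hq.1.1 q.2)).ne'

lemma rotationNumber_eq {p : ℝ × ℝ} (hp : p ∈ puncturedDisc) (hj : p.1 ≠ 0) :
    rotationNumber p = p.1 / (2 * |p.1|) +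
      p.1 / (2 * Real.pi) * (regularPart p (2 * (xZero p + 1)) + upperPart p) := by
  rw [rotationNumber_eq_parts hp hj, lowerPart_eq hp hj]
  have := abs_ne_zero.2 hj
  have := Real.pi_ne_zero
  field_simp
  ring

lemma rotationNumber_eq_of_one_lt {p : ℝ × ℝ} (hp : p ∈ puncturedDisc) (hj : p.1 ≠ 0)
    (hh : 1 < p.2) :
    rotationNumber p = p.1 / |p.1| + p.1 / (2 * Real.pi) *
      (regularPart p (2 * (xZero p + 1)) - regularPart p (2 * (xZero p - 1))) := by
  rw [rotationNumber_eq hp hj, upperPart_eq hp hj hh]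
  have := abs_ne_zero.2 hj
  have := Real.pi_ne_zero
  field_simp
  ring

/-! ### Continuity and one-sided limits of the rotation number -/

lemma isOpen_fst_ne_zero_or : IsOpen {p : ℝ × ℝ | p.1 ≠ 0 ∨ p.2 < 1} :=
  (isOpen_ne_fun continuous_fst continuous_const).union
    (isOpen_lt continuous_snd continuous_const)

lemma isOpen_one_lt_snd : IsOpen {p : ℝ × ℝ | 1 < p.2} :=
  isOpen_lt continuous_const continuous_snd

/-- The part of the rotation number that is continuous across `j = 0`, `h < 1`. -/
lemma continuousOn_smoothPart :
    ContinuousOn (fun p : ℝ × ℝ => p.1 / (2 * Real.pi) *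
      (regularPart p (2 * (xZero p + 1)) + upperPart p))
      (puncturedDisc ∩ {p | p.1 ≠ 0 ∨ p.2 < 1}) :=
  (continuousOn_fst.div_const _).mul
    ((continuousOn_regularPart_lower.mono Set.inter_subset_left).add continuousOn_upperPart)

/-- The part of the rotation number that is continuous across `j = 0`, `h > 1`. -/
lemma continuousOn_smoothPart_of_one_lt :
    ContinuousOn (fun p : ℝ × ℝ => p.1 / (2 * Real.pi) *
      (regularPart p (2 * (xZero p + 1)) - regularPart p (2 * (xZero p - 1))))
      (puncturedDisc ∩ {p | 1 < p.2}) :=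
  (continuousOn_fst.div_const _).mul
    ((continuousOn_regularPart_lower.mono Set.inter_subset_left).sub
      continuousOn_regularPart_upper)

lemma continuousAt_rotationNumber {p : ℝ × ℝ} (hp : p ∈ puncturedDisc) (hj : p.1 ≠ 0) :
    ContinuousAt rotationNumber p := by
  have hmem : puncturedDisc ∩ {p | p.1 ≠ 0 ∨ p.2 < 1} ∈ 𝓝 p :=
    (isOpen_puncturedDisc.inter isOpen_fst_ne_zero_or).mem_nhds ⟨hp, Or.inl hj⟩
  have hmem' : {p : ℝ × ℝ | p.1 ≠ 0} ∈ 𝓝 p :=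
    (isOpen_ne_fun continuous_fst continuous_const).mem_nhds hj
  have h1 := continuousOn_smoothPart.continuousAt hmem
  have h2 : ContinuousAt (fun p : ℝ × ℝ => p.1 / (2 * |p.1|)) p :=
    continuousAt_fst.div (by fun_prop) (mul_ne_zero two_ne_zero (abs_ne_zero.2 hj))
  refine (h2.add h1).congr ?_
  filter_upwards [hmem, hmem'] with q hq hq'
  exact (rotationNumber_eq hq.1 hq').symm

/-- One-sided limit of `Θ` at a point of the circle with `j = 0`. -/
lemma tendsto_rotationNumber {p : ℝ × ℝ} (hp : p ∈ puncturedDisc) (hj : p.1 = 0) (s : ℝ)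
    {l : Filter (ℝ × ℝ)} (hl : l ≤ 𝓝 p) (hs : ∀ᶠ q in l, q.1 ≠ 0 ∧ q.1 / |q.1| = s) :
    (p.2 < 1 → Filter.Tendsto rotationNumber l (𝓝 (s / 2))) ∧
    (1 < p.2 → Filter.Tendsto rotationNumber l (𝓝 s)) := by
  constructor
  · intro hh
    have hmem : puncturedDisc ∩ {p | p.1 ≠ 0 ∨ p.2 < 1} ∈ 𝓝 p :=
      (isOpen_puncturedDisc.inter isOpen_fst_ne_zero_or).mem_nhds ⟨hp, Or.inr hh⟩
    have h1 := (continuousOn_smoothPart.continuousAt hmem).tendsto.mono_left hl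
    -- The continuous part carries the factor `j`, so its limit is `0` and only the sign term
    -- survives.
    simp only [hj, zero_div, zero_mul] at h1
    have h2 := h1.const_add (s / 2)
    rw [add_zero] at h2
    refine h2.congr' ?_
    filter_upwards [hl hmem, hs] with q hq hq'
    rw [rotationNumber_eq hq.1 hq'.1, ← hq'.2, div_div, mul_comm |q.1|]
  · intro hh
    have hmem : puncturedDisc ∩ {p | 1 < p.2} ∈ 𝓝 p :=
      (isOpen_puncturedDisc.inter isOpen_one_lt_snd).mem_nhds ⟨hp, hh⟩
    have h1 := (continuousOn_smoothPart_of_one_lt.continuousAt hmem).tendsto.mono_left hl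
    simp only [hj, zero_div, zero_mul] at h1
    have h2 := h1.const_add s
    rw [add_zero] at h2
    refine h2.congr' ?_
    filter_upwards [hl hmem, hs] with q hq hq'
    rw [rotationNumber_eq_of_one_lt hq.1 hq'.1 hq.2, ← hq'.2]

/-! ### The rotation number as an angle plus a single-valued function -/

/-- The complex number `(1 - h) + i j`. -/
def polar (p : ℝ × ℝ) : ℂ := ⟨1 - p.2, p.1⟩

lemma continuous_polar : Continuous polar := by
  have : polar = fun p : ℝ × ℝ => ((1 - p.2 : ℝ) : ℂ) + (p.1 : ℂ) * Complex.I := by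
    funext p
    apply Complex.ext <;> simp [polar]
  rw [this]
  fun_prop

/-- The single-valued part of the rotation number: `Θ = 1 / 2 + arg / 2π + singleValuedPart`
modulo integers. -/
def singleValuedPart (p : ℝ × ℝ) : ℝ :=
  if 1 < p.2 then
    p.1 / (2 * Real.pi) *
      (regularPart p (2 * (xZero p + 1)) - regularPart p (2 * (xZero p - 1))) -
      (-polar p).arg / (2 * Real.pi)
  else
    p.1 / (2 * Real.pi) * (regularPart p (2 * (xZero p + 1)) + upperPart p) -
      (polar p).arg / (2 * Real.pi)

lemma arg_neg_polar {p : ℝ × ℝ} (hj : p.1 ≠ 0) :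
    (-polar p).arg = (polar p).arg - Real.pi * (p.1 / |p.1|) := by
  rcases lt_or_gt_of_ne hj with h | h
  · rw [Complex.arg_neg_eq_arg_add_pi_of_im_neg h, abs_of_neg h, div_neg, div_self hj]
    ring
  · rw [Complex.arg_neg_eq_arg_sub_pi_of_im_pos h, abs_of_pos h, div_self hj]
    ring

/-- The two formulas agree where both apply: passing from `arg (polar p)` to `arg (-polar p)` costs
`π sgn(j)`, which is exactly the `π / |j|` split off from `upperPart`. -/
lemma singleValuedPart_eq {p : ℝ × ℝ} (hp : p ∈ puncturedDisc) (hj : p.1 ≠ 0 ∨ p.2 < 1) :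
    singleValuedPart p = p.1 / (2 * Real.pi) * (regularPart p (2 * (xZero p + 1)) + upperPart p) -
      (polar p).arg / (2 * Real.pi) := by
  unfold singleValuedPart
  split_ifs with h
  · have hj' := hj.resolve_right (not_lt.2 h.le)
    rw [upperPart_eq hp hj' h, arg_neg_polar hj']
    have := abs_ne_zero.2 hj'
    have := Real.pi_ne_zero
    field_simp
    ring
  · rfl

lemma continuousOn_singleValuedPart : ContinuousOn singleValuedPart puncturedDisc := by
  intro p hp
  refine ContinuousAt.continuousWithinAt ?_
  by_cases hh : 1 < p.2
  · have hmem : puncturedDisc ∩ {p | 1 < p.2} ∈ 𝓝 p :=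
      (isOpen_puncturedDisc.inter isOpen_one_lt_snd).mem_nhds ⟨hp, hh⟩
    have h1 := continuousOn_smoothPart_of_one_lt.continuousAt hmem
    have h2 : ContinuousAt (fun p => (-polar p).arg) p := by
      refine (Complex.continuousAt_arg (Or.inl ?_)).comp (f := fun p => -polar p)
        continuous_polar.neg.continuousAt
      -- Here `-polar p` has real part `h - 1 > 0`, away from the cut of `arg`.
      simp [polar, hh]
    refine (h1.sub (h2.div_const (2 * Real.pi))).congr ?_
    filter_upwards [hmem] with q hq
    exact (if_pos hq.2).symm
  -- With `h ≤ 1` and the centre removed, `polar p` lies off the negative real axis.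
  · have hj : p.1 ≠ 0 ∨ p.2 < 1 := by
      by_contra hcon
      push Not at hcon
      exact hp.1 (Prod.ext hcon.1 (le_antisymm (not_lt.1 hh) hcon.2))
    have hmem : puncturedDisc ∩ {p | p.1 ≠ 0 ∨ p.2 < 1} ∈ 𝓝 p :=
      (isOpen_puncturedDisc.inter isOpen_fst_ne_zero_or).mem_nhds ⟨hp, hj⟩
    have h1 := continuousOn_smoothPart.continuousAt hmem
    have h2 : ContinuousAt (fun p => (polar p).arg) p := by
      refine (Complex.continuousAt_arg ?_).comp (f := polar) continuous_polar.continuousAt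
      rw [Complex.mem_slitPlane_iff]
      simpa [polar, or_comm] using hj
    refine (h1.sub (h2.div_const (2 * Real.pi))).congr ?_
    filter_upwards [hmem] with q hq
    exact (singleValuedPart_eq hq.1 hq.2).symm

/-- The sign term of `Θ` is `1/2` for `j > 0` and `-1/2` for `j < 0`, so the integer is `0` or `1`.
-/
lemma rotationNumber_eq_singleValuedPart {p : ℝ × ℝ} (hp : p ∈ puncturedDisc) (hj : p.1 ≠ 0) :
    ∃ n : ℤ, 1 / 2 + singleValuedPart p + (polar p).arg / (2 * Real.pi) =
      rotationNumber p + n := by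
  rw [singleValuedPart_eq hp (Or.inl hj), rotationNumber_eq hp hj]
  rcases lt_or_gt_of_ne hj with h | h
  · refine ⟨1, ?_⟩
    rw [abs_of_neg h]
    field_simp
    push_cast
    ring
  · refine ⟨0, ?_⟩
    rw [abs_of_pos h]
    field_simp
    push_cast
    ring

/-! ### Branches of the rotation number along the circuit -/

lemma circuit_mem {ε : ℝ} (hε : 0 < ε) (hε' : ε < 1 / 10) (t : ℝ) :
    circuit ε t ∈ puncturedDisc := by
  have e : (circuit ε t).1 ^ 2 + ((circuit ε t).2 - 1) ^ 2 = ε ^ 2 := by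
    simp only [circuit]
    linear_combination ε ^ 2 * Real.sin_sq_add_cos_sq t
  refine ⟨fun h => ?_, ?_⟩
  · rw [h] at e
    simp only [zero_pow two_ne_zero, sub_self, add_zero] at e
    exact (pow_pos hε 2).ne e
  · rw [e]; nlinarith

lemma continuous_circuit (ε : ℝ) : Continuous (circuit ε) := by
  unfold circuit; fun_prop

lemma circuit_two_pi (ε : ℝ) : circuit ε (2 * Real.pi) = circuit ε 0 := by
  simp [circuit]

lemma circuit_zero (ε : ℝ) : circuit ε 0 = (ε, 1) := by
  simp [circuit]

lemma reversedCircuit_two_pi (ε : ℝ) : reversedCircuit ε (2 * Real.pi) = (ε, 1) := by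
  simp [reversedCircuit, circuit]

lemma reversedCircuit_zero (ε : ℝ) : reversedCircuit ε 0 = (ε, 1) := by
  simp [reversedCircuit, circuit]

/-- Branches and transports are constrained only where `j ≠ 0`; density lets continuity carry the
constraint over the remaining parameters. -/
lemma dense_circuit_fst_ne_zero {ε : ℝ} (hε : 0 < ε) : Dense {t | (circuit ε t).1 ≠ 0} := by
  have hc : {t : ℝ | Real.cos t = 0}.Countable := by
    refine (Set.countable_range fun k : ℤ => (2 * (k : ℝ) + 1) * Real.pi / 2).mono ?_
    intro t ht
    obtain ⟨k, hk⟩ := Real.cos_eq_zero_iff.1 ht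
    exact ⟨k, hk.symm⟩
  refine (hc.dense_compl ℝ).mono fun t ht => ?_
  simpa [circuit, hε.ne'] using ht

lemma dense_reversedCircuit_fst_ne_zero {ε : ℝ} (hε : 0 < ε) :
    Dense {t | (reversedCircuit ε t).1 ≠ 0} := by
  simpa [reversedCircuit, circuit] using dense_circuit_fst_ne_zero hε

/-- The integers are closed in `ℝ`, so integrality passes to the closure; a continuous map from the
connected line to the discrete integers is constant. -/
lemma eq_int_of_dense {f : ℝ → ℝ} (hf : Continuous f) {A : Set ℝ} (hA : Dense A)
    (h : ∀ t ∈ A, ∃ n : ℤ, f t = n) : ∃ n : ℤ, ∀ t, f t = n := by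
  have hcl : IsClosed (Set.range ((↑) : ℤ → ℝ)) := Int.isClosedEmbedding_coe_real.isClosed_range
  have hall : ∀ t, f t ∈ Set.range ((↑) : ℤ → ℝ) := fun t =>
    (hcl.preimage hf).closure_subset_iff.2 (fun t ht => (h t ht).imp fun _ e => e.symm) (hA t)
  choose g hg using hall
  have hgc : Continuous g := by
    rw [Int.isClosedEmbedding_coe_real.isEmbedding.continuous_iff]
    exact hf.congr fun t => (hg t).symm
  refine ⟨g 0, fun t => ?_⟩
  rw [← hg, PreconnectedSpace.constant inferInstance hgc]

lemma IsRotationBranch.sub_eq {c : ℝ → ℝ × ℝ} {θ θ' : ℝ → ℝ} (hc : Dense {t | (c t).1 ≠ 0})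
    (h : IsRotationBranch c θ) (h' : IsRotationBranch c θ') (s t : ℝ) :
    θ s - θ t = θ' s - θ' t := by
  obtain ⟨n, hn⟩ := eq_int_of_dense (h.1.sub h'.1) hc fun t ht => by
    obtain ⟨m, hm⟩ := h.2 t ht
    obtain ⟨m', hm'⟩ := h'.2 t ht
    exact ⟨m - m', by rw [Pi.sub_apply, hm, hm']; push_cast; ring⟩
  have h1 := hn s
  have h2 := hn t
  simp only [Pi.sub_apply] at h1 h2
  linarith

lemma IsRotationBranch.exists_normalized {c : ℝ → ℝ × ℝ} {θ : ℝ → ℝ}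
    (h : IsRotationBranch c θ) (h0 : (c 0).1 ≠ 0) :
    ∃ θ' : ℝ → ℝ, IsRotationBranch c θ' ∧ θ' 0 = rotationNumber (c 0) := by
  obtain ⟨n, hn⟩ := h.2 0 h0
  refine ⟨fun t => θ t - n, ⟨h.1.sub continuous_const, fun t ht => ?_⟩, by
    simp only; rw [hn]; ring⟩
  obtain ⟨m, hm⟩ := h.2 t ht
  exact ⟨m - n, by simp only; rw [hm]; push_cast; ring⟩

/-- A continuous branch of the rotation number along `circuit ε`. -/
def rotationLift (ε t : ℝ) : ℝ :=
  1 / 2 + singleValuedPart (circuit ε t) + (t + Real.pi / 2) / (2 * Real.pi)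

/-- On the circuit `polar` equals `ε e^{i (t + π/2)}`, so `t + π/2` is a continuous choice of its
argument; this is the angle in `rotationLift`. -/
lemma polar_circuit (ε t : ℝ) :
    polar (circuit ε t) = ε * (Complex.cos ((t + Real.pi / 2 : ℝ) : ℂ) +
      Complex.sin ((t + Real.pi / 2 : ℝ) : ℂ) * Complex.I) := by
  rw [← Complex.ofReal_cos, ← Complex.ofReal_sin, Real.cos_add_pi_div_two,
    Real.sin_add_pi_div_two]
  apply Complex.ext <;> simp [polar, circuit, -Complex.ofReal_cos, -Complex.ofReal_sin]

lemma isRotationBranch_rotationLift {ε : ℝ} (hε : 0 < ε) (hε' : ε < 1 / 10) :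
    IsRotationBranch (circuit ε) (rotationLift ε) := by
  constructor
  · have := continuousOn_singleValuedPart.comp_continuous (continuous_circuit ε)
      (circuit_mem hε hε')
    unfold rotationLift
    fun_prop
  · intro t ht
    obtain ⟨n, hn⟩ := rotationNumber_eq_singleValuedPart (circuit_mem hε hε' t) ht
    have harg := Complex.arg_mul_cos_add_sin_mul_I_sub hε (t + Real.pi / 2)
    rw [← polar_circuit] at harg
    -- The floor counts the full turns between `t + π/2` and the principal argument.
    refine ⟨n - ⌊(Real.pi - (t + Real.pi / 2)) / (2 * Real.pi)⌋, ?_⟩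
    have e : (t + Real.pi / 2) / (2 * Real.pi) = (polar (circuit ε t)).arg / (2 * Real.pi) -
        ⌊(Real.pi - (t + Real.pi / 2)) / (2 * Real.pi)⌋ := by
      rw [eq_sub_iff_add_eq, ← eq_sub_iff_add_eq', ← sub_div, harg,
        mul_div_cancel_left₀ _ Real.two_pi_pos.ne']
    rw [rotationLift, e]
    push_cast
    linarith

lemma rotationLift_two_pi (ε : ℝ) : rotationLift ε (2 * Real.pi) = rotationLift ε 0 + 1 := by
  rw [rotationLift, rotationLift, circuit_two_pi]
  have := Real.pi_ne_zero
  field_simp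
  ring

lemma rotationLift_neg_two_pi (ε : ℝ) :
    rotationLift ε (-(2 * Real.pi)) = rotationLift ε 0 - 1 := by
  rw [rotationLift, rotationLift, show circuit ε (-(2 * Real.pi)) = circuit ε 0 by simp [circuit]]
  have := Real.pi_ne_zero
  field_simp
  ring

lemma isRotationBranch_reversed {ε : ℝ} (hε : 0 < ε) (hε' : ε < 1 / 10) :
    IsRotationBranch (reversedCircuit ε) (fun t => rotationLift ε (-t)) :=
  ⟨(isRotationBranch_rotationLift hε hε').1.comp continuous_neg,
    fun t ht => (isRotationBranch_rotationLift hε hε').2 (-t) ht⟩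

lemma exists_branch_circuit {ε : ℝ} (hε : 0 < ε) (hε' : ε < 1 / 10) :
    ∃ θ : ℝ → ℝ, IsRotationBranch (circuit ε) θ ∧ θ 0 = rotationNumber (ε, 1) := by
  rw [← circuit_zero ε]
  exact (isRotationBranch_rotationLift hε hε').exists_normalized
    (by rw [circuit_zero]; exact hε.ne')

lemma exists_branch_reversedCircuit {ε : ℝ} (hε : 0 < ε) (hε' : ε < 1 / 10) :
    ∃ θ : ℝ → ℝ, IsRotationBranch (reversedCircuit ε) θ ∧ θ 0 = rotationNumber (ε, 1) := by
  rw [← reversedCircuit_zero ε]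
  exact (isRotationBranch_reversed hε hε').exists_normalized
    (by rw [reversedCircuit_zero]; exact hε.ne')

lemma IsRotationBranch.variation_circuit {ε : ℝ} (hε : 0 < ε) (hε' : ε < 1 / 10) {θ : ℝ → ℝ}
    (h : IsRotationBranch (circuit ε) θ) : θ (2 * Real.pi) - θ 0 = 1 := by
  rw [h.sub_eq (dense_circuit_fst_ne_zero hε) (isRotationBranch_rotationLift hε hε'),
    rotationLift_two_pi]
  ring

lemma IsRotationBranch.variation_reversedCircuit {ε : ℝ} (hε : 0 < ε) (hε' : ε < 1 / 10)
    {θ : ℝ → ℝ} (h : IsRotationBranch (reversedCircuit ε) θ) : θ (2 * Real.pi) - θ 0 = -1 := by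
  rw [h.sub_eq (dense_reversedCircuit_fst_ne_zero hε) (isRotationBranch_reversed hε hε'),
    rotationLift_neg_two_pi, neg_zero]
  ring

/-! ### Transport and monodromy of the lattice -/

lemma mem_periodLattice {p : ℝ × ℝ} {z : ℂ} :
    z ∈ periodLattice p ↔ ∃ m n : ℤ, z = m + n * tau p := by
  simp only [periodLattice, AddSubgroup.mem_closure_pair, zsmul_eq_mul, mul_one, eq_comm]

/-- The lattice vectors with constant coordinates in the basis `1, -θ + i T` are transported. -/
lemma IsRotationBranch.isLatticeTransport {c : ℝ → ℝ × ℝ} {θ : ℝ → ℝ} (h : IsRotationBranch c θ)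
    (hT : Continuous fun t => returnTime (c t)) (m n : ℤ) :
    IsLatticeTransport c
      (fun t => m + n * (-(θ t : ℂ) + Complex.I * (returnTime (c t) : ℂ))) := by
  refine ⟨?_, fun t ht => ?_⟩
  · have := h.1
    fun_prop
  · obtain ⟨k, hk⟩ := h.2 t ht
    refine mem_periodLattice.2 ⟨m - n * k, n, ?_⟩
    simp only [hk, tau]
    push_cast
    ring

/-- The imaginary part divided by `T ≠ 0` gives the coefficient of `τ`; adding that multiple of `θ`
to the real part leaves an integer. Both are continuous and integral on a dense set, hence constant.
-/
lemma IsLatticeTransport.exists_eq {c : ℝ → ℝ × ℝ} {θ : ℝ → ℝ} {u : ℝ → ℂ}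
    (hc : Dense {t | (c t).1 ≠ 0}) (hu : IsLatticeTransport c u) (h : IsRotationBranch c θ)
    (hT : Continuous fun t => returnTime (c t)) (hT0 : ∀ t, returnTime (c t) ≠ 0) :
    ∃ m n : ℤ, ∀ t, u t = m + n * (-(θ t : ℂ) + Complex.I * (returnTime (c t) : ℂ)) := by
  have hre : ∀ (m n : ℤ) (p : ℝ × ℝ),
      ((m : ℂ) + n * tau p).re = m - n * rotationNumber p ∧
      ((m : ℂ) + n * tau p).im = n * returnTime p := by
    intro m n p
    simp [tau, sub_eq_add_neg]
  obtain ⟨n, hn⟩ := eq_int_of_dense (f := fun t => (u t).im / returnTime (c t))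
    ((Complex.continuous_im.comp hu.1).div hT hT0) hc fun t ht => by
      obtain ⟨m, n, e⟩ := mem_periodLattice.1 (hu.2 t ht)
      exact ⟨n, by simp only [e, (hre m n _).2]; exact mul_div_cancel_right₀ _ (hT0 t)⟩
  have him : ∀ t, (u t).im = n * returnTime (c t) := fun t => (div_eq_iff (hT0 t)).1 (hn t)
  obtain ⟨m, hm⟩ := eq_int_of_dense (f := fun t => (u t).re + n * θ t)
    ((Complex.continuous_re.comp hu.1).add (continuous_const.mul h.1)) hc fun t ht => by
      obtain ⟨m, n', e⟩ := mem_periodLattice.1 (hu.2 t ht)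
      obtain ⟨k, hk⟩ := h.2 t ht
      have hnn : (n' : ℝ) = n := by
        have := him t
        rw [e, (hre m n' _).2] at this
        exact mul_right_cancel₀ (hT0 t) this
      refine ⟨m + n * k, ?_⟩
      simp only [e, (hre m n' _).1, hk, hnn]
      push_cast
      ring
  refine ⟨m, n, fun t => ?_⟩
  apply Complex.ext
  · have := hm t
    simp
    linarith
  · simp [him t]

lemma IsLatticeTransport.monodromy {ε : ℝ} (hε : 0 < ε) (hε' : ε < 1 / 10) {u : ℝ → ℂ}
    {m₀ m₁ : ℤ} (hT : Continuous fun t => returnTime (reversedCircuit ε t))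
    (hu : IsLatticeTransport (reversedCircuit ε) u) (h0 : u 0 = m₀ + m₁ * tau (ε, 1)) :
    u (2 * Real.pi) = (m₀ + m₁ : ℤ) + m₁ * tau (ε, 1) := by
  obtain ⟨θ, hθ, hθ0⟩ := exists_branch_reversedCircuit hε hε'
  have hvar := hθ.variation_reversedCircuit hε hε'
  have hpos : ∀ t, returnTime (reversedCircuit ε t) ≠ 0 := fun t =>
    (returnTime_pos (circuit_mem hε hε' (-t))).ne'
  obtain ⟨m, n, e⟩ := hu.exists_eq (dense_reversedCircuit_fst_ne_zero hε) hθ hT hpos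
  have e0 := e 0
  have hp0 := hpos 0
  rw [reversedCircuit_zero] at e0 hp0
  rw [hθ0, h0, tau] at e0
  have hn : (m₁ : ℝ) = n := by
    have := congrArg Complex.im e0
    simp at this
    rcases this with h | h
    · exact_mod_cast h
    · exact absurd h hp0
  have hn' : m₁ = n := by exact_mod_cast hn
  subst hn'
  have hm : (m₀ : ℂ) = m := add_right_cancel e0
  -- The branch ends one below its start, so `-θ` gains `1` and the constant coordinates `(m₀, m₁)`
  -- yield `m₀ + m₁ (τ + 1)`.
  rw [e, reversedCircuit_two_pi, show θ (2 * Real.pi) = rotationNumber (ε, 1) - 1 by linarith,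
    ← hm, tau]
  push_cast
  ring

/-! ### Jumps along the circuit -/

lemma tendsto_rotationNumber_circuit {ε : ℝ} (hε : 0 < ε) (hε' : ε < 1 / 10) {t₀ s : ℝ}
    {l : Filter ℝ} (hl : l ≤ 𝓝 t₀) (h0 : Real.cos t₀ = 0)
    (hs : ∀ᶠ t in l, Real.cos t ≠ 0 ∧ Real.cos t / |Real.cos t| = s) :
    (Real.sin t₀ = -1 →
      Filter.Tendsto (fun t => rotationNumber (circuit ε t)) l (𝓝 (s / 2))) ∧
    (Real.sin t₀ = 1 →
      Filter.Tendsto (fun t => rotationNumber (circuit ε t)) l (𝓝 s)) := by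
  have key := tendsto_rotationNumber (circuit_mem hε hε' t₀) (by simp [circuit, h0]) s
    (l := l.map (circuit ε)) (((continuous_circuit ε).tendsto t₀).mono_left hl) (by
      rw [Filter.eventually_map]
      filter_upwards [hs] with t ht
      refine ⟨mul_ne_zero hε.ne' ht.1, ?_⟩
      simp only [circuit]
      rw [abs_mul, abs_of_pos hε, mul_div_mul_left _ _ hε.ne', ht.2])
  simp only [Filter.tendsto_map'_iff] at key
  refine ⟨fun h => key.1 ?_, fun h => key.2 ?_⟩ <;> simp only [circuit, h] <;> linarith

/-- The shift `c` moves the interval into `(-π/2, π/2)`: it is `0` to the left of `π/2` and `2π` to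
the right of `3π/2`. -/
lemma eventually_cos_pos {l : Filter ℝ} {a b c : ℝ} (hl : Set.Ioo a b ∈ l)
    (ha : -(Real.pi / 2) ≤ a - c) (hb : b - c ≤ Real.pi / 2)
    (hc : ∀ t, Real.cos (t - c) = Real.cos t) :
    ∀ᶠ t in l, Real.cos t ≠ 0 ∧ Real.cos t / |Real.cos t| = 1 := by
  filter_upwards [hl] with t ht
  have : 0 < Real.cos t := by
    rw [← hc]
    exact Real.cos_pos_of_mem_Ioo ⟨by linarith [ht.1], by linarith [ht.2]⟩
  exact ⟨this.ne', by rw [abs_of_pos this, div_self this.ne']⟩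

lemma eventually_cos_neg {l : Filter ℝ}
    (hl : Set.Ioo (Real.pi / 2) (3 * Real.pi / 2) ∈ l) :
    ∀ᶠ t in l, Real.cos t ≠ 0 ∧ Real.cos t / |Real.cos t| = -1 := by
  filter_upwards [hl] with t ht
  have : Real.cos t < 0 := Real.cos_neg_of_pi_div_two_lt_of_lt ht.1 (by linarith [ht.2])
  exact ⟨this.ne, by rw [abs_of_neg this, div_neg, div_self this.ne]⟩

end SphericalPendulum

end

theorem proposition7 :
    ∃ ε₀ : ℝ, 0 < ε₀ ∧
      -- `T` is a continuous single-valued function on the punctured disc of radius `ε₀`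
      ContinuousOn SphericalPendulum.returnTime
        {p : ℝ × ℝ | p ≠ (0, 1) ∧ p.1 ^ 2 + (p.2 - 1) ^ 2 < ε₀ ^ 2} ∧
      ∀ ε : ℝ, 0 < ε → ε < ε₀ →
        -- the roots, and the convergence of the integrals
        (∀ t : ℝ,
          -1 ≤ SphericalPendulum.xMinus (SphericalPendulum.circuit ε t) ∧
          SphericalPendulum.xMinus (SphericalPendulum.circuit ε t)
            < SphericalPendulum.xPlus (SphericalPendulum.circuit ε t) ∧
          SphericalPendulum.xPlus (SphericalPendulum.circuit ε t) ≤ 1 ∧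
          1 ≤ SphericalPendulum.xZero (SphericalPendulum.circuit ε t) ∧
          SphericalPendulum.xPlus (SphericalPendulum.circuit ε t)
            < SphericalPendulum.xZero (SphericalPendulum.circuit ε t) ∧
          (∀ x : ℝ, SphericalPendulum.P (SphericalPendulum.circuit ε t) x =
            2 * (x - SphericalPendulum.xMinus (SphericalPendulum.circuit ε t))
              * (x - SphericalPendulum.xPlus (SphericalPendulum.circuit ε t))
              * (x - SphericalPendulum.xZero (SphericalPendulum.circuit ε t))) ∧
          IntervalIntegrable
            (fun x => 1 / √(SphericalPendulum.P (SphericalPendulum.circuit ε t) x))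
            MeasureTheory.volume
            (SphericalPendulum.xMinus (SphericalPendulum.circuit ε t))
            (SphericalPendulum.xPlus (SphericalPendulum.circuit ε t)) ∧
          ((SphericalPendulum.circuit ε t).1 ≠ 0 →
            IntervalIntegrable
              (fun x => 1 / ((1 - x ^ 2) * √(SphericalPendulum.P (SphericalPendulum.circuit ε t) x)))
              MeasureTheory.volume
              (SphericalPendulum.xMinus (SphericalPendulum.circuit ε t))
              (SphericalPendulum.xPlus (SphericalPendulum.circuit ε t))) ∧
          0 < SphericalPendulum.returnTime (SphericalPendulum.circuit ε t)) ∧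
        -- `T` is continuous along the circuit and returns to its initial value
        (Continuous (fun t => SphericalPendulum.returnTime (SphericalPendulum.circuit ε t)) ∧
          SphericalPendulum.returnTime (SphericalPendulum.circuit ε (2 * Real.pi)) =
            SphericalPendulum.returnTime (SphericalPendulum.circuit ε 0)) ∧
        -- the integral `Θ` is continuous along the circuit except for the jumps
        -- `1 → -1` at `t = π/2` and `-1/2 → 1/2` at `t = 3π/2`, which add up to `-1`
        (∀ t : ℝ, (SphericalPendulum.circuit ε t).1 ≠ 0 →
          ContinuousAt
            (fun s => SphericalPendulum.rotationNumber (SphericalPendulum.circuit ε s)) t) ∧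
        Filter.Tendsto (fun t => SphericalPendulum.rotationNumber (SphericalPendulum.circuit ε t))
          (𝓝[<] (Real.pi / 2)) (𝓝 1) ∧
        Filter.Tendsto (fun t => SphericalPendulum.rotationNumber (SphericalPendulum.circuit ε t))
          (𝓝[>] (Real.pi / 2)) (𝓝 (-1)) ∧
        Filter.Tendsto (fun t => SphericalPendulum.rotationNumber (SphericalPendulum.circuit ε t))
          (𝓝[<] (3 * Real.pi / 2)) (𝓝 (-1 / 2)) ∧
        Filter.Tendsto (fun t => SphericalPendulum.rotationNumber (SphericalPendulum.circuit ε t))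
          (𝓝[>] (3 * Real.pi / 2)) (𝓝 (1 / 2)) ∧
        -- a continuous branch of `Θ` exists; it varies by `-1` along the circuit with `(h, j)`
        -- positively oriented, hence by `+1` when the circuit is run the other way
        (∃ θ : ℝ → ℝ,
          SphericalPendulum.IsRotationBranch (SphericalPendulum.reversedCircuit ε) θ ∧
          θ 0 = SphericalPendulum.rotationNumber (ε, 1)) ∧
        (∀ θ : ℝ → ℝ,
          SphericalPendulum.IsRotationBranch (SphericalPendulum.reversedCircuit ε) θ →
          θ (2 * Real.pi) - θ 0 = -1) ∧
        (∃ θ : ℝ → ℝ,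
          SphericalPendulum.IsRotationBranch (SphericalPendulum.circuit ε) θ ∧
          θ 0 = SphericalPendulum.rotationNumber (ε, 1)) ∧
        (∀ θ : ℝ → ℝ,
          SphericalPendulum.IsRotationBranch (SphericalPendulum.circuit ε) θ →
          θ (2 * Real.pi) - θ 0 = 1) ∧
        -- monodromy of the lattices `ℤ + ℤ τ`: the basis `(1, τ)` returns as `(1, τ + 1)`
        (∀ m : Fin 2 → ℤ, ∃ u : ℝ → ℂ,
          SphericalPendulum.IsLatticeTransport (SphericalPendulum.reversedCircuit ε) u ∧
          u 0 = (m 0 : ℂ) + (m 1 : ℂ) * SphericalPendulum.tau (ε, 1)) ∧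
        (∀ (u : ℝ → ℂ) (m : Fin 2 → ℤ),
          SphericalPendulum.IsLatticeTransport (SphericalPendulum.reversedCircuit ε) u →
          u 0 = (m 0 : ℂ) + (m 1 : ℂ) * SphericalPendulum.tau (ε, 1) →
          u (2 * Real.pi) =
            (((!![1, 1; 0, 1] : Matrix (Fin 2) (Fin 2) ℤ) *ᵥ m) 0 : ℂ) +
              (((!![1, 1; 0, 1] : Matrix (Fin 2) (Fin 2) ℤ) *ᵥ m) 1 : ℂ) *
                SphericalPendulum.tau (ε, 1)) := by
  refine ⟨1 / 10, by norm_num, SphericalPendulum.continuousOn_returnTime, fun ε hε hε' => ?_⟩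
  have hmem := SphericalPendulum.circuit_mem hε hε'
  have hT : Continuous fun t =>
      SphericalPendulum.returnTime (SphericalPendulum.circuit ε t) :=
    SphericalPendulum.continuousOn_returnTime.comp_continuous
      (SphericalPendulum.continuous_circuit ε) hmem
  have hT' : Continuous fun t =>
      SphericalPendulum.returnTime (SphericalPendulum.reversedCircuit ε t) :=
    hT.comp continuous_neg
  have hpi := Real.pi_pos
  have hc3 : Real.cos (3 * Real.pi / 2) = 0 := by
    rw [show 3 * Real.pi / 2 = Real.pi / 2 + Real.pi by ring, Real.cos_add_pi,
      Real.cos_pi_div_two, neg_zero]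
  have hs3 : Real.sin (3 * Real.pi / 2) = -1 := by
    rw [show 3 * Real.pi / 2 = Real.pi / 2 + Real.pi by ring, Real.sin_add_pi,
      Real.sin_pi_div_two]
  refine ⟨fun t => ?_, ⟨hT, by rw [SphericalPendulum.circuit_two_pi]⟩, fun t ht => ?_, ?_, ?_,
    ?_, ?_, SphericalPendulum.exists_branch_reversedCircuit hε hε',
    fun θ h => h.variation_reversedCircuit hε hε',
    SphericalPendulum.exists_branch_circuit hε hε',
    fun θ h => h.variation_circuit hε hε', fun m => ?_, fun u m hu h0 => ?_⟩
  · obtain ⟨h1, h2, h3, h4, h5, h6, hP⟩ := SphericalPendulum.roots_spec (hmem t)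
    refine ⟨h1, h3, h4, h5, h6, hP, ?_, fun hj => ?_, SphericalPendulum.returnTime_pos (hmem t)⟩
    · simpa using SphericalPendulum.intervalIntegrable_inv_sqrt_P (hmem t)
        (g := fun _ => 1) continuous_const (fun _ _ => one_ne_zero)
    · refine SphericalPendulum.intervalIntegrable_inv_sqrt_P (hmem t)
        (g := fun x => 1 - x ^ 2) (by fun_prop) fun x hx => ?_
      have h7 := SphericalPendulum.neg_one_lt_xMinus (hmem t) hj
      have h8 := SphericalPendulum.xPlus_lt_one (hmem t) (Or.inl hj)
      -- The factor `1 - x²` has no zero on `[x⁻, x⁺]`, because `j ≠ 0` keeps this interval inside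
      -- `(-1, 1)`.
      have h9 := mul_pos (show 0 < 1 + x by linarith [hx.1]) (show 0 < 1 - x by linarith [hx.2])
      nlinarith
  · exact (SphericalPendulum.continuousAt_rotationNumber (hmem t) ht).comp
      (f := SphericalPendulum.circuit ε) (SphericalPendulum.continuous_circuit ε).continuousAt
  · exact (SphericalPendulum.tendsto_rotationNumber_circuit hε hε' nhdsWithin_le_nhds
      Real.cos_pi_div_two (SphericalPendulum.eventually_cos_pos (c := 0)
        (Ioo_mem_nhdsLT (show -(Real.pi / 2) < Real.pi / 2 by linarith))
        (by linarith) (by linarith) (by simp))).2 Real.sin_pi_div_two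
  · exact (SphericalPendulum.tendsto_rotationNumber_circuit hε hε' nhdsWithin_le_nhds
      Real.cos_pi_div_two (SphericalPendulum.eventually_cos_neg
        (Ioo_mem_nhdsGT (by linarith)))).2 Real.sin_pi_div_two
  · exact (SphericalPendulum.tendsto_rotationNumber_circuit hε hε' nhdsWithin_le_nhds
      hc3 (SphericalPendulum.eventually_cos_neg (Ioo_mem_nhdsLT (by linarith)))).1 hs3
  · exact (SphericalPendulum.tendsto_rotationNumber_circuit hε hε' nhdsWithin_le_nhds
      hc3 (SphericalPendulum.eventually_cos_pos (c := 2 * Real.pi)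
        (Ioo_mem_nhdsGT (show 3 * Real.pi / 2 < 5 * Real.pi / 2 by linarith))
        (by linarith) (by linarith) Real.cos_sub_two_pi)).1 hs3
  · obtain ⟨θ, hθ, hθ0⟩ := SphericalPendulum.exists_branch_reversedCircuit hε hε'
    refine ⟨_, hθ.isLatticeTransport hT' (m 0) (m 1), ?_⟩
    simp only [hθ0, SphericalPendulum.reversedCircuit_zero, SphericalPendulum.tau]
  · have := hu.monodromy hε hε' hT' h0
    simpa [Matrix.mulVec, dotProduct, Fin.sum_univ_two] using this
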